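/- **Setting.** Let $X$ be a set and $R$ a set of pairs of nonempty words over $X$ such that the presentation $\langle X|R\rangle$ is Adian: neither the left graph (vertex set $X$, one edge for each $(u,v)\in R$, joining the first letters of $u$ and $v$) nor the right graph (the same with last letters) has a closed path; loops and parallel edges count as closed paths. Let $M=Inv\langle X|R\rangle$ be the inverse monoid with this presentation. An $R$-word is a side of a relation in $R$; each relation $r=s$ may be used in both directions. A birooted inverse word graph is a graph with edges labeled by $X\cup X^{-1}$ in which $(a,x,b)$ is an edge if and only if $(b,x^{-1},a)$ is one, together with an initial vertex and a terminal vertex; homomorphisms preserve labeled edges and both roots, and an embedding is an injective homomorphism. A source (sink) is a vertex at which no edge labeled by a letter of $X$ ends (starts). A positively labeled path is a path all of whose edges are labeled by letters of $X$. Let $w\in X^+$ contain the $R$-word $r$ as a subword, and let $r_w(i)$ be the $i$-th occurrence of $r$ in $w$. A segment from $a$ to $b$ labeled by a side $r'$ of a relation $r'=s'$ is unsaturated if $s'$ cannot be read from $a$ to $b$; an elementary expansion sews on a new segment labeled by $s'$ from $a$ to $b$. * Stephen's approximations: $\Gamma_0(w)$ is the linear automaton of $w$, and $\Gamma_{n+1}(w)$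 is obtained from $\Gamma_n(w)$ by performing all elementary expansions that are possible in $\Gamma_n(w)$ and then folding edges until the graph is deterministic. $S\Gamma(w)$ is the Schützenberger graph of $w$, i.e. the strongly connected component of the Cayley graph of $M$ that contains $w$, with initial vertex $ww^{-1}$ and terminal vertex $w$. * $\Delta_0(r_w(i))$ is the linear automaton of $w$; $\Delta_1(r_w(i))$ is obtained by performing the elementary expansions (one for each relation with side $r$) on the segment $r_w(i)$ only; for $n\ge 1$, $\Delta_{n+1}(r_w(i))$ is obtained from $\Delta_n(r_w(i))$ by performing, without folding, all elementary expansions on those unsaturated segments that start from or terminate at an interior vertex of a segment that was sewn on at the $n$-th step. $\varphi_n:\Delta_n(r_w(i))\to\Delta_{n+1}(r_w(i))$ is the canonical homomorphism, and $(\alpha,\Delta(r_w(i)),\beta)$ is the direct limit of the graphs $\Delta_n(r_w(i))$ along the maps $\varphi_n$. **Proposition 3.** For every occurrence $r_w(i)$ of $r$ in $w$: (i) for every $n\in\mathbb N$ there is exactly one homomorphism $\theta_n:\Delta_n(r_w(i))\to\Gamma_n(w)$ of birooted inverse word graphs, and it is an embedding; (ii) for every $n\in\mathbb N$ the graph $\Delta_n(r_w(i))$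 is deterministic (so nothing can be folded in the construction), and $\varphi_n$ is an embedding and is the only homomorphism of birooted inverse word graphs from $\Delta_n(r_w(i))$ to $\Delta_{n+1}(r_w(i))$; (iii) $(\alpha,\Delta(r_w(i)),\beta)$ embeds as a birooted inverse word graph in $(ww^{-1},S\Gamma(w),w)$; its vertex $\alpha$ is a source and is its only source, and $\beta$ is a sink and is its only sink; (iv) for every vertex $\gamma\ne\alpha$ of $\Delta(r_w(i))$ there is a positively labeled path in $\Delta(r_w(i))$ from $\alpha$ to $\gamma$, and for every vertex $\gamma\neq\beta$ there is a positively labeled path in $\Delta(r_w(i))$ from $\gamma$ to $\beta$; (v) every positively labeled path in $\Delta(r_w(i))$ can be extended to a positively labeled path from $\alpha$ to $\beta$ (a positively labeled transversal). -/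

import Mathlib

universe u

namespace AdianInverse

/-! ### Positive presentations and Adian presentations

Positive words over `X` are lists of letters; a presentation is a set `R` of pairs of words. -/

section Presentation

variable {X : Type u}

/-- The multigraph with vertex set `X` that has, for every relation `(u, v) ∈ R`, one edge joining
the letters `f u` and `f v` has no closed path: it has no loop, no two parallel edges, and the
underlying simple graph is acyclic. -/
def CycleFree (R : Set (List X × List X)) (f : List X → Option X) : Prop :=
  (∀ ρ ∈ R, f ρ.1 ≠ f ρ.2) ∧
  Set.InjOn (fun ρ : List X × List X => s(f ρ.1, f ρ.2)) R ∧
  (SimpleGraph.fromRel fun a b : X => ∃ ρ ∈ R, f ρ.1 = some a ∧ f ρ.2 = some b).IsAcyclic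

/-- Adian presentation: both sides of every relation are nonempty positive words, and neither the
left graph (first letters) nor the right graph (last letters) has a closed path. -/
structure IsAdian (R : Set (List X × List X)) : Prop where
  positive : ∀ ρ ∈ R, ρ.1 ≠ [] ∧ ρ.2 ≠ []
  left : CycleFree R List.head?
  right : CycleFree R List.getLast?

/-- `r = s` is a defining relation, read in one of the two directions. -/
def IsRelation (R : Set (List X × List X)) (r s : List X) : Prop :=
  (r, s) ∈ R ∨ (s, r) ∈ R

/-- `R`-words: the sides of the relations. -/
def IsRWord (R : Set (List X × List X)) (r : List X) : Prop :=
  ∃ s, IsRelation R r s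

end Presentation

/-! ### Birooted inverse word graphs -/

/-- A birooted inverse word graph over `X`. Only the positive edges `(u, x, v)`, `x ∈ X`, are
recorded: by the definition of an inverse word graph, `(v, x⁻¹, u)` is an edge if and only if
`(u, x, v)` is one. -/
structure WordGraph (X : Type u) where
  V : Type u
  Edge : V → X → V → Prop
  start : V
  finish : V

namespace WordGraph

variable {X : Type u}

/-- `l` is the sequence of edges of a positively labeled path from `a` to `b`. -/
def IsPath (G : WordGraph X) : G.V → List (G.V × X × G.V) → G.V → Prop
  | a, [], b => a = b
  | a, e :: l, b => e.1 = a ∧ G.Edge e.1 e.2.1 e.2.2 ∧ G.IsPath e.2.2 l b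

/-- The positive word `w` labels a path from `a` to `b`. -/
def Reads (G : WordGraph X) (a : G.V) (w : List X) (b : G.V) : Prop :=
  ∃ l, G.IsPath a l b ∧ l.map (fun e => e.2.1) = w

/-- No folding can be performed, neither at edges labeled by a letter nor at edges labeled by the
inverse of a letter. -/
def Deterministic (G : WordGraph X) : Prop :=
  (∀ a x b c, G.Edge a x b → G.Edge a x c → b = c) ∧
  (∀ a x b c, G.Edge b x a → G.Edge c x a → b = c)

/-- A source: no positive edge ends there. -/
def IsSource (G : WordGraph X) (v : G.V) : Prop := ∀ a x, ¬ G.Edge a x v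

/-- A sink: no positive edge starts there. -/
def IsSink (G : WordGraph X) (v : G.V) : Prop := ∀ x b, ¬ G.Edge v x b

/-- Homomorphisms of birooted inverse word graphs. Since edges are triples, such a homomorphism
is an embedding if and only if it is injective on vertices. -/
@[ext]
structure Hom (G H : WordGraph X) where
  toFun : G.V → H.V
  map_edge : ∀ a x b, G.Edge a x b → H.Edge (toFun a) x (toFun b)
  map_start : toFun G.start = H.start
  map_finish : toFun G.finish = H.finish

/-- An embedding of birooted inverse word graphs. -/
def Hom.IsEmbedding {G H : WordGraph X} (f : Hom G H) : Prop := Function.Injective f.toFun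

/-- The linear automaton of `w`; its vertices are the prefixes of `w`. -/
def linear (w : List X) : WordGraph X where
  V := {p : List X // p <+: w}
  Edge a x b := b.1 = a.1 ++ [x]
  start := ⟨[], List.nil_prefix⟩
  finish := ⟨w, List.prefix_rfl⟩

/-! #### Elementary expansions -/

/-- Two vertices `src`, `tgt` of `G` and two words, `side` and `other`: the data of an elementary
expansion that sews on a segment labeled by `other` at the ends of a segment labeled by `side`. -/
structure Segment (G : WordGraph X) where
  src : G.V
  side : List X
  other : List X
  tgt : G.V

/-- `side = other` is a relation, `side` can be read from `src` to `tgt`, and `other` cannot. -/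
def Segment.Unsaturated {G : WordGraph X} (R : Set (List X × List X)) (q : G.Segment) : Prop :=
  IsRelation R q.side q.other ∧ G.Reads q.src q.side q.tgt ∧ ¬ G.Reads q.src q.other q.tgt

/-- The vertices of the graph obtained from `G` by sewing on, for each `q ∈ Q`, a linear graph of
`q.other`: the old vertices and the interior vertices of the new segments. -/
abbrev SewVertex (G : WordGraph X) (Q : Set G.Segment) : Type u :=
  G.V ⊕ (Σ q : Q, Fin (q.1.other.length - 1))

/-- The vertex reached on the new segment of `q` after `j` letters, `0 ≤ j ≤ q.other.length`. -/
def sewPoint (G : WordGraph X) (Q : Set G.Segment) (q : Q) : ℕ → G.SewVertex Q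
  | 0 => Sum.inl q.1.src
  | j + 1 => if h : j < q.1.other.length - 1 then Sum.inr ⟨q, ⟨j, h⟩⟩ else Sum.inl q.1.tgt

inductive SewEdge (G : WordGraph X) (Q : Set G.Segment) :
    G.SewVertex Q → X → G.SewVertex Q → Prop
  | old {a x b} : G.Edge a x b → SewEdge G Q (Sum.inl a) x (Sum.inl b)
  | new (q : Q) {j x} : q.1.other[j]? = some x →
      SewEdge G Q (G.sewPoint Q q j) x (G.sewPoint Q q (j + 1))

/-- Sew on, for each `q ∈ Q`, a segment labeled by `q.other` from `q.src` to `q.tgt`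
(simultaneously, and without any folding). -/
def sew (G : WordGraph X) (Q : Set G.Segment) : WordGraph X where
  V := G.SewVertex Q
  Edge := G.SewEdge Q
  start := Sum.inl G.start
  finish := Sum.inl G.finish

/-- The inclusion of `G` into a graph obtained from it by elementary expansions. -/
def sewIncl (G : WordGraph X) (Q : Set G.Segment) : Hom G (G.sew Q) where
  toFun := Sum.inl
  map_edge _ _ _ h := SewEdge.old h
  map_start := rfl
  map_finish := rfl

/-! #### Determination and full expansions -/

/-- The least equivalence relation on the vertices that is closed under folding. -/
inductive FoldRel (G : WordGraph X) : G.V → G.V → Prop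
  | refl (a) : FoldRel G a a
  | symm {a b} : FoldRel G a b → FoldRel G b a
  | trans {a b c} : FoldRel G a b → FoldRel G b c → FoldRel G a c
  | fold_out {a a' x b b'} : FoldRel G a a' → G.Edge a x b → G.Edge a' x b' → FoldRel G b b'
  | fold_in {a a' x b b'} : FoldRel G b b' → G.Edge a x b → G.Edge a' x b' → FoldRel G a a'

def foldSetoid (G : WordGraph X) : Setoid G.V where
  r := G.FoldRel
  iseqv := ⟨FoldRel.refl, FoldRel.symm, FoldRel.trans⟩

/-- The determinized form of `G`. -/
def determinize (G : WordGraph X) : WordGraph X where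
  V := Quotient G.foldSetoid
  Edge a x b := ∃ a' b', G.Edge a' x b' ∧ Quotient.mk _ a' = a ∧ Quotient.mk _ b' = b
  start := Quotient.mk _ G.start
  finish := Quotient.mk _ G.finish

/-- The full expansion: perform all elementary expansions that are possible in `G`, then
determinize. -/
def fullExpansion (R : Set (List X × List X)) (G : WordGraph X) : WordGraph X :=
  (G.sew {q | q.Unsaturated R}).determinize

/-! #### Direct limits of sequences -/

/-- The vertices of the direct limit of `G 0 → G 1 → G 2 → ⋯`. -/
abbrev LimitVertex (G : ℕ → WordGraph X) (φ : ∀ n, Hom (G n) (G (n + 1))) : Type u :=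
  Quot fun a b : (Σ n, (G n).V) => ∃ n v, a = ⟨n, v⟩ ∧ b = ⟨n + 1, (φ n).toFun v⟩

/-- The direct limit of `G 0 → G 1 → G 2 → ⋯`. -/
def limit (G : ℕ → WordGraph X) (φ : ∀ n, Hom (G n) (G (n + 1))) : WordGraph X where
  V := LimitVertex G φ
  Edge a x b := ∃ n u v, (G n).Edge u x v ∧ Quot.mk _ ⟨n, u⟩ = a ∧ Quot.mk _ ⟨n, v⟩ = b
  start := Quot.mk _ ⟨0, (G 0).start⟩
  finish := Quot.mk _ ⟨0, (G 0).finish⟩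

end WordGraph

open WordGraph

section Construction

variable {X : Type u}

/-- Stephen's approximations `Γ_n(w)`. -/
def Γ (R : Set (List X × List X)) (w : List X) : ℕ → WordGraph X
  | 0 => linear w
  | n + 1 => (Γ R w n).fullExpansion R

/-- The pairs consisting of the graph `Δ_n` and the set of segments that are to be expanded in
`Δ_n` in order to obtain `Δ_{n+1}`. The occurrence of `r` in `w` is the one that follows the
prefix `p` of `w`. In `Δ_0`, the linear automaton of `w`, only this occurrence is expanded; in
`Δ_{n+1}`, only the unsaturated segments that start from or terminate at an interior vertex of
a segment that was sewn on in the step from `Δ_n` to `Δ_{n+1}`. -/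
def stage (R : Set (List X × List X)) (w r p : List X) : ℕ → (G : WordGraph X) × Set G.Segment
  | 0 => ⟨linear w,
      {q | q.Unsaturated R ∧ q.src.1 = p ∧ q.side = r ∧ q.tgt.1 = p ++ r}⟩
  | n + 1 => ⟨(stage R w r p n).1.sew (stage R w r p n).2,
      {q | q.Unsaturated R ∧ ((∃ z, q.src = Sum.inr z) ∨ (∃ z, q.tgt = Sum.inr z))}⟩

/-- The approximations `Δ_n(r_w(i))`, for the occurrence of `r` in `w` after the prefix `p`. -/
def Δ (R : Set (List X × List X)) (w r p : List X) (n : ℕ) : WordGraph X :=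
  (stage R w r p n).1

/-- The canonical homomorphisms `φ_n : Δ_n(r_w(i)) → Δ_{n+1}(r_w(i))`. -/
def φ (R : Set (List X × List X)) (w r p : List X) (n : ℕ) :
    Hom (Δ R w r p n) (Δ R w r p (n + 1)) :=
  sewIncl _ (stage R w r p n).2

/-- The graph `Δ(r_w(i))`: the direct limit of the `Δ_n(r_w(i))`. -/
def ΔLimit (R : Set (List X × List X)) (w r p : List X) : WordGraph X :=
  limit (Δ R w r p) (φ R w r p)

end Construction

/-! ### The inverse monoid of a presentation and its Schützenberger graphs -/

section Schutzenberger

variable {X : Type u}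

/-- A positive word as a word over `X ∪ X⁻¹`; the letter `x` is `(x, true)` and `x⁻¹` is
`(x, false)`. -/
def posWord (w : List X) : FreeMonoid (X × Bool) := FreeMonoid.ofList (w.map fun x => (x, true))

/-- The formal inverse of a word over `X ∪ X⁻¹`. -/
def invWord (t : FreeMonoid (X × Bool)) : FreeMonoid (X × Bool) :=
  FreeMonoid.ofList (FreeGroup.invRev t.toList)

/-- The generators of the Vagner congruence, and the relations of the presentation. -/
inductive InvRel (R : Set (List X × List X)) :
    FreeMonoid (X × Bool) → FreeMonoid (X × Bool) → Prop
  | regular (t) : InvRel R (t * invWord t * t) t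
  | comm (s t) : InvRel R (s * invWord s * (t * invWord t)) (t * invWord t * (s * invWord s))
  | rel {r s} : (r, s) ∈ R → InvRel R (posWord r) (posWord s)

/-- `Inv⟨X | R⟩`. -/
abbrev Inv (R : Set (List X × List X)) : Type u := (conGen (InvRel R)).Quotient

/-- The element of `Inv⟨X | R⟩` represented by a word over `X ∪ X⁻¹`. -/
def Inv.mk (R : Set (List X × List X)) (t : FreeMonoid (X × Bool)) : Inv R := (t : Inv R)

theorem Inv.mk_regular (R : Set (List X × List X)) (t : FreeMonoid (X × Bool)) :
    Inv.mk R (t * invWord t) * Inv.mk R t = Inv.mk R t :=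
  (Con.eq _).2 (ConGen.Rel.of _ _ (InvRel.regular t))

/-- The Schützenberger automaton `(ww⁻¹, SΓ(w), w)` of a positive word `w`: the strongly connected
component of the Cayley graph of `Inv⟨X | R⟩` that contains `w`. -/
def SΓ (R : Set (List X × List X)) (w : List X) : WordGraph X where
  V := {m : Inv R // (∃ a, Inv.mk R (posWord w) * a = m) ∧ ∃ b, m * b = Inv.mk R (posWord w)}
  Edge m x m' := m.1 * Inv.mk R (posWord [x]) = m'.1
  start := ⟨Inv.mk R (posWord w * invWord (posWord w)),
    ⟨Inv.mk R (invWord (posWord w)), rfl⟩, ⟨Inv.mk R (posWord w), Inv.mk_regular R _⟩⟩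
  finish := ⟨Inv.mk R (posWord w), ⟨1, mul_one _⟩, ⟨1, mul_one _⟩⟩

end Schutzenberger

end AdianInverse

open AdianInverse AdianInverse.WordGraph

namespace AdianInverse

/-! ### Adian presentations -/

section Presentation

variable {X : Type u} {R : Set (List X × List X)} {f : List X → Option X}

/-! The heart is a local condition, `Tame`: at each vertex the labels of outgoing edges span a
connected part of the left graph, and if both first letters of a relation occur there, its two sides
can be read to a common vertex; dually for incoming edges and the right graph. An elementary
expansion adds a letter adjacent to one already present. In a forest a new letter has only one
neighbour among the old ones, and without parallel edges this pair of letters determines the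
relation. Hence distinct new edges never fold and the condition persists (`Tame.extend`,
`LocallyTame.sew`), so Stephen's approximations grow without identifications.

An interior vertex of a fresh segment has one edge in and one edge out, so a segment with an end
there cannot already have its other side present. Thus what is expanded in `Δ` is also expanded in
`Γ`, and `Δ` embeds stage by stage (`exists_embedding`); determinism and reachability give
uniqueness (`Hom.unique`).

The limit of the `Γ R w n` is deterministic and closed under the relations, so the inverse monoid
acts on it by partial injections. A vertex of `Δ` reached by `u` is sent to `ww⁻¹u`, and the action
of that element on the initial vertex recovers the vertex (`toSΓ_injective`). The source, sink and
path statements hold because sewing along readable segments, and passing to the limit, preserve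
`Transversal`. -/

theorem IsRelation.symm {r s : List X} (h : IsRelation R r s) : IsRelation R s r := Or.symm h

theorem IsAdian.ne_nil (hR : IsAdian R) {r s : List X} (h : IsRelation R r s) : r ≠ [] :=
  h.elim (fun h => (hR.positive _ h).1) fun h => (hR.positive _ h).2

theorem CycleFree.apply_ne (hf : CycleFree R f) {r s : List X} (h : IsRelation R r s) :
    f r ≠ f s :=
  h.elim (fun h => hf.1 _ h) fun h => (hf.1 _ h).symm

/-- Parallel edges are excluded; if the relations are used in opposite directions, the coincidence
of edges would produce a loop. -/
theorem CycleFree.eq_of_apply_eq (hf : CycleFree R f) {r s r' s' : List X}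
    (h : IsRelation R r s) (h' : IsRelation R r' s') (hr : f r = f r') (hs : f s = f s') :
    r = r' ∧ s = s' := by
  have hne := hf.apply_ne h
  rcases h with h | h <;> rcases h' with h' | h'
  · simpa using hf.2.1 h h' (by simp [hr, hs])
  · have := hf.2.1 h h' (by simp [hr, hs])
    simp only [Prod.mk.injEq] at this
    exact absurd (this.1 ▸ hs.symm) hne
  · have := hf.2.1 h h' (by simp [hr, hs])
    simp only [Prod.mk.injEq] at this
    exact absurd (this.1 ▸ hr.symm) hne.symm
  · have := hf.2.1 h h' (by simp [hr, hs])
    simpa [and_comm] using this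

/-- The simple graph underlying the left graph (`f = List.head?`) or the right graph
(`f = List.getLast?`) of a presentation. -/
def letterGraph (R : Set (List X × List X)) (f : List X → Option X) : SimpleGraph X :=
  SimpleGraph.fromRel fun a b : X => ∃ ρ ∈ R, f ρ.1 = some a ∧ f ρ.2 = some b

theorem CycleFree.adj (hf : CycleFree R f) {r s : List X} {a b : X} (h : IsRelation R r s)
    (ha : f r = some a) (hb : f s = some b) : (letterGraph R f).Adj a b := by
  refine (SimpleGraph.fromRel_adj _ _ _).2 ⟨?_, ?_⟩
  · rintro rfl
    exact hf.apply_ne h (ha.trans hb.symm)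
  · exact h.imp (fun h => ⟨_, h, ha, hb⟩) fun h => ⟨_, h, hb, ha⟩

end Presentation

/-! ### Connected sets of vertices of a forest -/

section Forest

variable {V : Type u} {T : SimpleGraph V} {S S' : Set V}

/-- Otherwise a path inside `S` and the two edges at `b` would close up to a cycle; formally, the
edge from `a₁` to `b` would not be a bridge. -/
theorem eq_of_adj_of_preconnected (hT : T.IsAcyclic) (hS : (T.induce S).Preconnected)
    {a₁ a₂ b : V} (h₁ : a₁ ∈ S) (h₂ : a₂ ∈ S) (hb : b ∉ S) (e₁ : T.Adj a₁ b)
    (e₂ : T.Adj a₂ b) : a₁ = a₂ := by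
  by_contra hne
  have hbr := SimpleGraph.isAcyclic_iff_forall_adj_isBridge.1 hT e₁
  rw [SimpleGraph.isBridge_iff] at hbr
  refine hbr ?_
  -- Edges inside `S` avoid `b`, so they survive the removal of the edge `a₁b`.
  let g : T.induce S →g T \ SimpleGraph.fromEdgeSet {s(a₁, b)} :=
    { toFun := Subtype.val
      map_rel' := by
        rintro ⟨x, hx⟩ ⟨y, hy⟩ h
        have h : T.Adj x y := h
        refine (SimpleGraph.sdiff_adj _ _ _ _).2 ⟨h, ?_⟩
        simp only [SimpleGraph.fromEdgeSet_adj, Set.mem_singleton_iff, Sym2.eq_iff]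
        rintro ⟨⟨rfl, rfl⟩ | ⟨rfl, rfl⟩, -⟩ <;> contradiction }
  refine ((hS ⟨a₁, h₁⟩ ⟨a₂, h₂⟩).map g).trans (SimpleGraph.Adj.reachable ?_)
  refine (SimpleGraph.sdiff_adj _ _ _ _).2 ⟨e₂, ?_⟩
  simp only [SimpleGraph.fromEdgeSet_adj, Set.mem_singleton_iff, Sym2.eq_iff]
  rintro ⟨⟨h, -⟩ | ⟨-, h⟩, -⟩
  · exact hne h.symm
  · exact hb (h ▸ h₁)

theorem preconnected_induce_of_adj (hS : (T.induce S).Preconnected) (hSS : S ⊆ S')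
    (h : ∀ b ∈ S', b ∉ S → ∃ a ∈ S, T.Adj a b) : (T.induce S').Preconnected := by
  have key : ∀ b : S', ∃ a : S, (T.induce S').Reachable b ⟨a.1, hSS a.2⟩ := by
    rintro ⟨b, hb⟩
    by_cases hbS : b ∈ S
    · exact ⟨⟨b, hbS⟩, SimpleGraph.Reachable.refl _⟩
    · obtain ⟨a, ha, hab⟩ := h b hb hbS
      exact ⟨⟨a, ha⟩, SimpleGraph.Adj.reachable (G := T.induce S') hab.symm⟩
  intro b b'
  obtain ⟨a, ha⟩ := key b
  obtain ⟨a', ha'⟩ := key b'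
  exact (ha.trans ((hS a a').map (SimpleGraph.induceHomOfLE T hSS).toHom)).trans ha'.symm

theorem preconnected_induce_of_subsingleton (hS : S.Subsingleton) :
    (T.induce S).Preconnected := by
  rintro ⟨a, ha⟩ ⟨b, hb⟩
  cases hS ha hb
  exact SimpleGraph.Reachable.refl _

end Forest

/-! ### The local structure of the approximations -/

section Tame

variable {X : Type u} {R : Set (List X × List X)} {f : List X → Option X}

/-- The local condition on the edges at a vertex that excludes folding. With `E v x b` saying that
an edge labeled by `x` leads from `v` to `b`, and with `Rd v r t` saying that `r` can be read from
`v` to `t`, it treats the outgoing edges (`f = List.head?`); with the converse relations it treats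
the incoming edges (`f = List.getLast?`). -/
structure Tame (R : Set (List X × List X)) (f : List X → Option X) {V : Type u}
    (E : V → X → V → Prop) (Rd : V → List X → V → Prop) : Prop where
  det : ∀ {v x b c}, E v x b → E v x c → b = c
  conn : ∀ v, ((letterGraph R f).induce {x | ∃ b, E v x b}).Preconnected
  sat : ∀ {v r s a b}, IsRelation R r s → f r = some a → f s = some b → (∃ c, E v a c) →
    (∃ c, E v b c) → ∃ t, Rd v r t ∧ Rd v s t

variable {V V' : Type u} {E : V → X → V → Prop} {Rd : V → List X → V → Prop}
  {E' : V' → X → V' → Prop} {Rd' : V' → List X → V' → Prop}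

theorem Tame.of_subsingleton (hf : CycleFree R f)
    (h : ∀ v x b x' b', E v x b → E v x' b' → x = x' ∧ b = b') : Tame R f E Rd where
  det h₁ h₂ := (h _ _ _ _ _ h₁ h₂).2
  conn v := preconnected_induce_of_subsingleton fun _ hx _ hy =>
    (h _ _ _ _ _ hx.choose_spec hy.choose_spec).1
  sat hrs ha hb := by
    rintro ⟨c, hc⟩ ⟨c', hc'⟩
    obtain ⟨rfl, -⟩ := h _ _ _ _ _ hc hc'
    exact absurd (ha.trans hb.symm) (hf.apply_ne hrs)

/-- Only the edges at a vertex matter. This carries the condition through the determinization of a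
graph that is already deterministic. -/
theorem Tame.transport (h : Tame R f E Rd) (i : V → V') (hi : Function.Surjective i)
    (hE : ∀ {v x c}, E' (i v) x c ↔ ∃ b, E v x b ∧ i b = c)
    (hRd : ∀ {v r t}, Rd v r t → Rd' (i v) r (i t)) : Tame R f E' Rd' := by
  have hex : ∀ v x, (∃ c, E' (i v) x c) ↔ ∃ c, E v x c := fun v x =>
    ⟨fun ⟨c, hc⟩ => let ⟨b, hb, _⟩ := hE.1 hc; ⟨b, hb⟩, fun ⟨b, hb⟩ => ⟨_, hE.2 ⟨b, hb, rfl⟩⟩⟩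
  refine ⟨fun {v x b c} hb hc => ?_, fun v => ?_, fun {v r s a b} hrs ha hb hc hc' => ?_⟩
  · obtain ⟨v, rfl⟩ := hi v
    obtain ⟨b, hb', rfl⟩ := hE.1 hb
    obtain ⟨c, hc', rfl⟩ := hE.1 hc
    rw [h.det hb' hc']
  · obtain ⟨v, rfl⟩ := hi v
    rw [show {x | ∃ b, E' (i v) x b} = {x | ∃ b, E v x b} from Set.ext fun x => hex v x]
    exact h.conn v
  · obtain ⟨v, rfl⟩ := hi v
    obtain ⟨t, h₁, h₂⟩ := h.sat hrs ha hb ((hex _ _).1 hc) ((hex _ _).1 hc')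
    exact ⟨i t, hRd h₁, hRd h₂⟩

/-- The local condition survives if a new segment is sewn on at every unsaturated segment. -/
theorem Tame.extend (hf : CycleFree R f) (hsome : ∀ r s, IsRelation R r s → ∃ a, f r = some a)
    (h : Tame R f E Rd) (i : V → V') (N : V → List X → List X → V → V' → Prop)
    (hfun : ∀ {v r t t'}, Rd v r t → Rd v r t' → t = t')
    (hfirst : ∀ {v r t a}, Rd v r t → f r = some a → ∃ c, E v a c)
    (hRd : ∀ {v r t}, Rd v r t → Rd' (i v) r (i t))
    (hE : ∀ {v x b}, E v x b → E' (i v) x (i b))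
    (hN : ∀ {v r s t c c'}, N v r s t c → N v r s t c' → c = c')
    (hnew : ∀ {v x c}, E' (i v) x c → (∃ b, E v x b ∧ i b = c) ∨ ∃ r s t, IsRelation R r s ∧
      Rd v r t ∧ ¬ Rd v s t ∧ f s = some x ∧ N v r s t c)
    (hsew : ∀ {v r s t}, IsRelation R r s → Rd v r t → ¬ Rd v s t → Rd' (i v) s (i t))
    (hother : ∀ z, z ∉ Set.range i → ∀ x b x' b', E' z x b → E' z x' b' → x = x' ∧ b = b') :
    Tame R f E' Rd' := by
  have hT : (letterGraph R f).IsAcyclic := hf.2.2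
  -- The first letter of a missing side is new at `v`: otherwise `sat` makes both sides readable to
  -- a common vertex, which is `t` because `r` determines its endpoint.
  have notMem : ∀ {v r s t x}, IsRelation R r s → Rd v r t → ¬ Rd v s t → f s = some x →
      ¬ ∃ c, E v x c := by
    intro v r s t x hrs hr hs hx hc
    obtain ⟨a, ha⟩ := hsome r s hrs
    obtain ⟨t', h₁, h₂⟩ := h.sat hrs ha hx (hfirst hr ha) hc
    exact hs (hfun h₁ hr ▸ h₂)
  have new_of_notMem : ∀ {v x}, (∃ c, E' (i v) x c) → (¬ ∃ c, E v x c) → ∃ r s t a,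
      IsRelation R r s ∧ Rd v r t ∧ ¬ Rd v s t ∧ f r = some a ∧ f s = some x ∧ ∃ c, E v a c := by
    rintro v x ⟨c, hc⟩ hx
    obtain ⟨b, hb, -⟩ | ⟨r, s, t, hrs, hr, hs, hx, -⟩ := hnew hc
    · exact absurd ⟨b, hb⟩ hx
    · obtain ⟨a, ha⟩ := hsome r s hrs
      exact ⟨r, s, t, a, hrs, hr, hs, ha, hx, hfirst hr ha⟩
  -- The new letter `b` was introduced by some relation, through a neighbour among the old letters.
  -- It has only one such neighbour, namely `a`, so that relation is `r = s`, and its missing side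
  -- has been sewn on.
  have sat_of_notMem : ∀ {v r s a b}, IsRelation R r s → f r = some a → f s = some b →
      (∃ c, E v a c) → (¬ ∃ c, E v b c) → (∃ c, E' (i v) b c) →
      ∃ t, Rd' (i v) r t ∧ Rd' (i v) s t := by
    intro v r s a b hrs ha hb hc hnc hc'
    obtain ⟨r', s', t, a', hrs', hr', hs', ha', hb', hc''⟩ := new_of_notMem hc' hnc
    obtain rfl := eq_of_adj_of_preconnected hT (h.conn v) hc hc'' hnc (hf.adj hrs ha hb)
      (hf.adj hrs' ha' hb')
    obtain ⟨rfl, rfl⟩ := hf.eq_of_apply_eq hrs hrs' (ha.trans ha'.symm) (hb.trans hb'.symm)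
    exact ⟨i t, hRd hr', hsew hrs hr' hs'⟩
  refine ⟨fun {v x b c} hb hc => ?_, fun v => ?_, fun {v r s a b} hrs ha hb hc hc' => ?_⟩
  · by_cases hv : v ∈ Set.range i
    · obtain ⟨v, rfl⟩ := hv
      obtain ⟨b, hb', rfl⟩ | ⟨r, s, t, hrs, hr, hs, hx, hn⟩ := hnew hb <;>
      obtain ⟨c, hc', rfl⟩ | ⟨r', s', t', hrs', hr', hs', hx', hn'⟩ := hnew hc
      · rw [h.det hb' hc']
      · exact absurd ⟨b, hb'⟩ (notMem hrs' hr' hs' hx')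
      · exact absurd ⟨c, hc'⟩ (notMem hrs hr hs hx)
      -- Two new edges with one label: the forest forces equal first letters of `r` and `r'`, hence
      -- equal relations, equal endpoints and the same segment.
      · obtain ⟨a, ha⟩ := hsome r s hrs
        obtain ⟨a', ha'⟩ := hsome r' s' hrs'
        obtain rfl := eq_of_adj_of_preconnected hT (h.conn v) (hfirst hr ha) (hfirst hr' ha')
          (notMem hrs hr hs hx) (hf.adj hrs ha hx) (hf.adj hrs' ha' hx')
        obtain ⟨rfl, rfl⟩ := hf.eq_of_apply_eq hrs hrs' (ha.trans ha'.symm) (hx.trans hx'.symm)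
        obtain rfl := hfun hr hr'
        exact hN hn hn'
    · exact (hother v hv _ _ _ _ hb hc).2
  · by_cases hv : v ∈ Set.range i
    · obtain ⟨v, rfl⟩ := hv
      refine preconnected_induce_of_adj (h.conn v) (fun x ⟨b, hb⟩ => ⟨_, hE hb⟩) fun x hx hxn => ?_
      obtain ⟨r, s, t, a, hrs, -, -, ha, hx, hc⟩ := new_of_notMem hx hxn
      exact ⟨a, hc, hf.adj hrs ha hx⟩
    · exact preconnected_induce_of_subsingleton fun _ hx _ hy =>
        (hother v hv _ _ _ _ hx.choose_spec hy.choose_spec).1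
  · by_cases hv : v ∈ Set.range i
    · obtain ⟨v, rfl⟩ := hv
      by_cases hva : ∃ c, E v a c <;> by_cases hvb : ∃ c, E v b c
      · obtain ⟨t, h₁, h₂⟩ := h.sat hrs ha hb hva hvb
        exact ⟨i t, hRd h₁, hRd h₂⟩
      · exact sat_of_notMem hrs ha hb hva hvb hc'
      · obtain ⟨t, h₁, h₂⟩ := sat_of_notMem hrs.symm hb ha hvb hva hc
        exact ⟨t, h₂, h₁⟩
      · obtain ⟨r₁, s₁, t₁, a₁, hrs₁, -, -, ha₁, hx₁, hc₁⟩ := new_of_notMem hc hva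
        obtain ⟨r₂, s₂, t₂, a₂, hrs₂, -, -, ha₂, hx₂, hc₂⟩ := new_of_notMem hc' hvb
        -- Two new letters cannot be adjacent: the old letters together with `a` stay connected, so
        -- `b` would have a single neighbour among them, making `a` equal to the old letter `a₂`.
        have hS : ((letterGraph R f).induce (insert a {x | ∃ c, E v x c})).Preconnected := by
          refine preconnected_induce_of_adj (h.conn v) (Set.subset_insert _ _) fun x hx hxn => ?_
          obtain rfl | hx := hx
          · exact ⟨a₁, hc₁, hf.adj hrs₁ ha₁ hx₁⟩
          · exact absurd hx hxn
        have hab := hf.adj hrs ha hb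
        have hbn : b ∉ insert a {x | ∃ c, E v x c} := by
          rintro (rfl | hb)
          · exact hab.ne rfl
          · exact hvb hb
        have := eq_of_adj_of_preconnected hT hS (Set.mem_insert _ _) (Or.inr hc₂) hbn hab
          (hf.adj hrs₂ ha₂ hx₂)
        exact absurd (this ▸ hc₂) hva
    · obtain ⟨c, hc⟩ := hc
      obtain ⟨c', hc'⟩ := hc'
      obtain ⟨rfl, -⟩ := hother v hv _ _ _ _ hc hc'
      exact absurd (ha.trans hb.symm) (hf.apply_ne hrs)

end Tame

end AdianInverse

namespace AdianInverse

namespace WordGraph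

variable {X : Type u} {G H K : WordGraph X} {R : Set (List X × List X)}

/-! ### Paths and labels of paths -/

theorem isPath_append {a b : G.V} {l₁ l₂ : List (G.V × X × G.V)} :
    G.IsPath a (l₁ ++ l₂) b ↔ ∃ c, G.IsPath a l₁ c ∧ G.IsPath c l₂ b := by
  induction l₁ generalizing a with
  | nil => simp [IsPath]
  | cons e l ih => simp [IsPath, ih, and_assoc]

theorem reads_nil {a b : G.V} : G.Reads a [] b ↔ a = b := by
  simp [Reads, IsPath]

theorem reads_cons {a b : G.V} {x : X} {w : List X} :
    G.Reads a (x :: w) b ↔ ∃ c, G.Edge a x c ∧ G.Reads c w b := by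
  constructor
  · rintro ⟨_ | ⟨⟨a', y, c⟩, l⟩, hl, hw⟩
    · simp at hw
    · obtain ⟨rfl, he, hl⟩ := hl
      simp only [List.map_cons, List.cons.injEq] at hw
      exact ⟨c, hw.1 ▸ he, l, hl, hw.2⟩
  · rintro ⟨c, he, l, hl, hw⟩
    exact ⟨(a, x, c) :: l, ⟨rfl, he, hl⟩, by simp [hw]⟩

theorem reads_append {a b : G.V} {w₁ w₂ : List X} :
    G.Reads a (w₁ ++ w₂) b ↔ ∃ c, G.Reads a w₁ c ∧ G.Reads c w₂ b := by
  induction w₁ generalizing a with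
  | nil => simp [reads_nil]
  | cons x w ih =>
    simp only [List.cons_append, reads_cons, ih]
    exact ⟨fun ⟨c, h, d, h₁, h₂⟩ => ⟨d, ⟨c, h, h₁⟩, h₂⟩, fun ⟨d, ⟨c, h, h₁⟩, h₂⟩ => ⟨c, h, d, h₁, h₂⟩⟩

theorem reads_singleton {a b : G.V} {x : X} : G.Reads a [x] b ↔ G.Edge a x b := by
  simp [reads_cons, reads_nil]

theorem Reads.map {a b : G.V} {w : List X} (f : Hom G H) (h : G.Reads a w b) :
    H.Reads (f.toFun a) w (f.toFun b) := by
  induction w generalizing a with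
  | nil => rw [reads_nil] at *; rw [h]
  | cons x w ih =>
    obtain ⟨c, he, h⟩ := reads_cons.1 h
    exact reads_cons.2 ⟨_, f.map_edge _ _ _ he, ih h⟩

theorem Deterministic.reads_right (hG : G.Deterministic) {a b c : G.V} {w : List X}
    (hb : G.Reads a w b) (hc : G.Reads a w c) : b = c := by
  induction w generalizing a with
  | nil => exact (reads_nil.1 hb).symm.trans (reads_nil.1 hc)
  | cons x w ih =>
    obtain ⟨d, hd, hb⟩ := reads_cons.1 hb
    obtain ⟨d', hd', hc⟩ := reads_cons.1 hc
    obtain rfl := hG.1 _ _ _ _ hd hd'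
    exact ih hb hc

theorem Deterministic.reads_left (hG : G.Deterministic) {a b c : G.V} {w : List X}
    (hb : G.Reads b w a) (hc : G.Reads c w a) : b = c := by
  induction w generalizing b c with
  | nil => exact (reads_nil.1 hb).trans (reads_nil.1 hc).symm
  | cons x w ih =>
    obtain ⟨d, hd, hb⟩ := reads_cons.1 hb
    obtain ⟨d', hd', hc⟩ := reads_cons.1 hc
    obtain rfl := ih hb hc
    exact hG.2 _ _ _ _ hd hd'

theorem Reads.exists_edge_head {a b : G.V} {w : List X} {x : X} (h : G.Reads a w b)
    (hx : w.head? = some x) : ∃ c, G.Edge a x c := by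
  obtain ⟨y, w, rfl⟩ : ∃ y v, w = y :: v := by cases w <;> simp_all
  obtain rfl : y = x := by simpa using hx
  obtain ⟨c, hc, -⟩ := reads_cons.1 h
  exact ⟨c, hc⟩

theorem Reads.exists_edge_getLast {a b : G.V} {w : List X} {x : X} (h : G.Reads a w b)
    (hx : w.getLast? = some x) : ∃ c, G.Edge c x b := by
  obtain ⟨v, rfl⟩ := List.getLast?_eq_some_iff.1 hx
  obtain ⟨c, -, hc⟩ := reads_append.1 h
  exact ⟨c, reads_singleton.1 hc⟩

/-! ### Homomorphisms -/

namespace Hom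

protected def id (G : WordGraph X) : Hom G G := ⟨id, fun _ _ _ h => h, rfl, rfl⟩

def comp (g : Hom H K) (f : Hom G H) : Hom G K where
  toFun := g.toFun ∘ f.toFun
  map_edge _ _ _ h := g.map_edge _ _ _ (f.map_edge _ _ _ h)
  map_start := by rw [Function.comp_apply, f.map_start, g.map_start]
  map_finish := by rw [Function.comp_apply, f.map_finish, g.map_finish]

/-- The image of a vertex is forced by any positive word leading to it from the initial vertex. -/
theorem unique (hG : ∀ v, ∃ u, G.Reads G.start u v) (hH : H.Deterministic) (f g : Hom G H) :
    f = g := by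
  ext v
  obtain ⟨u, hu⟩ := hG v
  have h₁ := hu.map f
  have h₂ := hu.map g
  rw [f.map_start] at h₁
  rw [g.map_start] at h₂
  exact hH.reads_right h₁ h₂

end Hom

/-- The image of a segment under a homomorphism. -/
abbrev Segment.map (f : Hom G H) (q : G.Segment) : H.Segment :=
  ⟨f.toFun q.src, q.side, q.other, f.toFun q.tgt⟩

/-! ### Sewing on segments -/

section Sew

variable {Q : Set G.Segment}

theorem sewPoint_length {q : Q} (hq : q.1.other ≠ []) :
    G.sewPoint Q q q.1.other.length = Sum.inl q.1.tgt := by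
  obtain ⟨n, hn⟩ : ∃ n, q.1.other.length = n + 1 :=
    Nat.exists_eq_succ_of_ne_zero (by simpa using hq)
  rw [hn, sewPoint, dif_neg (by omega)]

theorem sewPoint_succ_of_lt {q : Q} {j : ℕ} (h : j < q.1.other.length - 1) :
    G.sewPoint Q q (j + 1) = Sum.inr ⟨q, ⟨j, h⟩⟩ := dif_pos h

theorem sewPoint_succ_of_not_lt {q : Q} {j : ℕ} (h : ¬ j < q.1.other.length - 1) :
    G.sewPoint Q q (j + 1) = Sum.inl q.1.tgt := dif_neg h

theorem sew_reads_take (q : Q) (j : ℕ) (hj : j ≤ q.1.other.length) :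
    (G.sew Q).Reads (Sum.inl q.1.src) (q.1.other.take j) (G.sewPoint Q q j) := by
  induction j with
  | zero => exact reads_nil.2 rfl
  | succ j ih =>
    rw [List.take_succ_eq_append_getElem hj]
    exact reads_append.2 ⟨_, ih (by omega), reads_singleton.2 (SewEdge.new q (by simp))⟩

theorem sew_reads_drop (q : Q) (hq : q.1.other ≠ []) (j : ℕ) (hj : j ≤ q.1.other.length) :
    (G.sew Q).Reads (G.sewPoint Q q j) (q.1.other.drop j) (Sum.inl q.1.tgt) := by
  induction hj using Nat.decreasingInduction with
  | self => rw [List.drop_length, sewPoint_length hq]; exact reads_nil.2 rfl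
  | of_succ j hj ih =>
    rw [List.drop_eq_getElem_cons hj]
    exact reads_cons.2 ⟨_, SewEdge.new q (by simp), ih⟩

theorem sew_reads_other (q : Q) (hq : q.1.other ≠ []) :
    (G.sew Q).Reads (Sum.inl q.1.src) q.1.other (Sum.inl q.1.tgt) :=
  sew_reads_drop q hq 0 (Nat.zero_le _)

theorem sew_edge_out_inl {v : G.V} {x : X} {c : (G.sew Q).V}
    (h : (G.sew Q).Edge (Sum.inl v) x c) : (∃ b, G.Edge v x b ∧ Sum.inl b = c) ∨
      ∃ q : Q, q.1.src = v ∧ q.1.other.head? = some x ∧ G.sewPoint Q q 1 = c := by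
  generalize ha : (Sum.inl v : (G.sew Q).V) = a at h
  cases h with
  | old h => obtain rfl := Sum.inl.inj ha; exact Or.inl ⟨_, h, rfl⟩
  | @new q j x hx =>
    obtain ⟨hj, -⟩ := List.getElem?_eq_some_iff.1 hx
    cases j with
    | zero => exact Or.inr ⟨q, (Sum.inl.inj ha).symm, by rw [List.head?_eq_getElem?, hx], rfl⟩
    | succ j => rw [sewPoint_succ_of_lt (by omega)] at ha; cases ha

theorem sew_edge_in_inl {v : G.V} {x : X} {c : (G.sew Q).V}
    (h : (G.sew Q).Edge c x (Sum.inl v)) : (∃ b, G.Edge b x v ∧ Sum.inl b = c) ∨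
      ∃ q : Q, q.1.tgt = v ∧ q.1.other.getLast? = some x ∧
        G.sewPoint Q q (q.1.other.length - 1) = c := by
  generalize ha : (Sum.inl v : (G.sew Q).V) = a at h
  cases h with
  | old h => obtain rfl := Sum.inl.inj ha; exact Or.inl ⟨_, h, rfl⟩
  | @new q j x hx =>
    obtain ⟨hj, -⟩ := List.getElem?_eq_some_iff.1 hx
    by_cases hj' : j < q.1.other.length - 1
    · rw [sewPoint_succ_of_lt hj'] at ha; cases ha
    · rw [sewPoint, dif_neg hj'] at ha
      obtain rfl : j = q.1.other.length - 1 := by omega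
      exact Or.inr ⟨q, (Sum.inl.inj ha).symm, by rw [List.getLast?_eq_getElem?, hx], rfl⟩

theorem sew_edge_out_inr {q : Q} {k : Fin (q.1.other.length - 1)} {x : X} {c : (G.sew Q).V}
    (h : (G.sew Q).Edge (Sum.inr ⟨q, k⟩) x c) :
    q.1.other[k.1 + 1]? = some x ∧ G.sewPoint Q q (k.1 + 2) = c := by
  generalize ha : (Sum.inr ⟨q, k⟩ : (G.sew Q).V) = a at h
  cases h with
  | old h => cases ha
  | @new q' j x hx =>
    obtain ⟨hj, -⟩ := List.getElem?_eq_some_iff.1 hx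
    cases j with
    | zero => cases ha
    | succ j =>
      rw [sewPoint_succ_of_lt (by omega)] at ha
      cases ha
      exact ⟨hx, rfl⟩

theorem sew_edge_in_inr {q : Q} {k : Fin (q.1.other.length - 1)} {x : X} {c : (G.sew Q).V}
    (h : (G.sew Q).Edge c x (Sum.inr ⟨q, k⟩)) :
    q.1.other[k.1]? = some x ∧ G.sewPoint Q q k.1 = c := by
  generalize ha : (Sum.inr ⟨q, k⟩ : (G.sew Q).V) = a at h
  cases h with
  | old h => cases ha
  | @new q' j x hx =>
    by_cases hj' : j < q'.1.other.length - 1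
    · rw [sewPoint_succ_of_lt hj'] at ha
      cases ha
      exact ⟨hx, rfl⟩
    · rw [sewPoint, dif_neg hj'] at ha; cases ha

/-- An interior vertex lies on its own segment only, so no branching occurs there. With the incoming
version this drives both the absence of folding and the embedding of `Δ`. -/
theorem sew_edge_out_inr_unique {z : Σ q : Q, Fin (q.1.other.length - 1)} {x x' : X}
    {c c' : (G.sew Q).V} (h : (G.sew Q).Edge (Sum.inr z) x c)
    (h' : (G.sew Q).Edge (Sum.inr z) x' c') : x = x' ∧ c = c' := by
  obtain ⟨h₁, rfl⟩ := sew_edge_out_inr h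
  obtain ⟨h₂, rfl⟩ := sew_edge_out_inr h'
  exact ⟨Option.some.inj (h₁.symm.trans h₂), rfl⟩

theorem sew_edge_in_inr_unique {z : Σ q : Q, Fin (q.1.other.length - 1)} {x x' : X}
    {c c' : (G.sew Q).V} (h : (G.sew Q).Edge c x (Sum.inr z))
    (h' : (G.sew Q).Edge c' x' (Sum.inr z)) : x = x' ∧ c = c' := by
  obtain ⟨h₁, rfl⟩ := sew_edge_in_inr h
  obtain ⟨h₂, rfl⟩ := sew_edge_in_inr h'
  exact ⟨Option.some.inj (h₁.symm.trans h₂), rfl⟩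

/-- The extension of a homomorphism to graphs obtained by elementary expansions. -/
def sewMap (f : Hom G H) (Q : Set G.Segment) (Q' : Set H.Segment)
    (h : ∀ q ∈ Q, q.map f ∈ Q') : Hom (G.sew Q) (H.sew Q') where
  toFun := Sum.map f.toFun fun z => ⟨⟨z.1.1.map f, h _ z.1.2⟩, z.2⟩
  map_edge := by
    have key : ∀ (q : Q) j, Sum.map f.toFun (fun z => ⟨⟨z.1.1.map f, h _ z.1.2⟩, z.2⟩)
        (G.sewPoint Q q j) = H.sewPoint Q' ⟨q.1.map f, h _ q.2⟩ j := by
      rintro q (_ | j)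
      · rfl
      · by_cases hj : j < q.1.other.length - 1
        · exact (congrArg _ (sewPoint_succ_of_lt hj)).trans
            (sewPoint_succ_of_lt (q := ⟨q.1.map f, h _ q.2⟩) hj).symm
        · exact (congrArg _ (sewPoint_succ_of_not_lt hj)).trans
            (sewPoint_succ_of_not_lt (q := ⟨q.1.map f, h _ q.2⟩) hj).symm
    intro a x b e
    cases e with
    | old e => exact SewEdge.old (f.map_edge _ _ _ e)
    | new q hx => rw [key, key]; exact SewEdge.new ⟨q.1.map f, h _ q.2⟩ hx
  map_start := congrArg Sum.inl f.map_start
  map_finish := congrArg Sum.inl f.map_finish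

theorem sewMap_injective {f : Hom G H} {Q' : Set H.Segment} {h : ∀ q ∈ Q, q.map f ∈ Q'}
    (hf : f.IsEmbedding) : (sewMap f Q Q' h).IsEmbedding := by
  refine Sum.map_injective.2 ⟨hf, ?_⟩
  rintro ⟨⟨⟨a, r, s, b⟩, hq⟩, k⟩ ⟨⟨⟨a', r', s', b'⟩, hq'⟩, k'⟩ e
  obtain rfl : a = a' := hf (congrArg (fun z => z.1.1.src) e)
  obtain rfl : r = r' := congrArg (fun z => z.1.1.side) e
  obtain rfl : s = s' := congrArg (fun z => z.1.1.other) e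
  obtain rfl : b = b' := hf (congrArg (fun z => z.1.1.tgt) e)
  obtain rfl : k = k' := eq_of_heq (Sigma.mk.inj e).2
  rfl

end Sew

/-! ### Determinization -/

/-- In a deterministic graph equality is itself closed under folding. -/
theorem FoldRel.eq (hG : G.Deterministic) {a b : G.V} (h : G.FoldRel a b) : a = b := by
  induction h with
  | refl => rfl
  | symm _ ih => exact ih.symm
  | trans _ _ ih₁ ih₂ => exact ih₁.trans ih₂
  | fold_out _ h₁ h₂ ih => subst ih; exact hG.1 _ _ _ _ h₁ h₂
  | fold_in _ h₁ h₂ ih => subst ih; exact hG.2 _ _ _ _ h₁ h₂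

def toDeterminize (G : WordGraph X) : Hom G G.determinize where
  toFun := Quotient.mk _
  map_edge _ _ _ h := ⟨_, _, h, rfl, rfl⟩
  map_start := rfl
  map_finish := rfl

theorem toDeterminize_injective (hG : G.Deterministic) : G.toDeterminize.IsEmbedding :=
  fun _ _ h => FoldRel.eq hG (Quotient.exact h)

theorem determinize_edge_out (hG : G.Deterministic) {v : G.V} {x : X} {c : G.determinize.V} :
    G.determinize.Edge (G.toDeterminize.toFun v) x c ↔
      ∃ b, G.Edge v x b ∧ G.toDeterminize.toFun b = c := by
  constructor
  · rintro ⟨a, b, h, ha, hb⟩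
    exact ⟨b, toDeterminize_injective hG ha ▸ h, hb⟩
  · rintro ⟨b, h, rfl⟩
    exact G.toDeterminize.map_edge _ _ _ h

theorem determinize_edge_in (hG : G.Deterministic) {v : G.V} {x : X} {c : G.determinize.V} :
    G.determinize.Edge c x (G.toDeterminize.toFun v) ↔
      ∃ b, G.Edge b x v ∧ G.toDeterminize.toFun b = c := by
  constructor
  · rintro ⟨b, a, h, hb, ha⟩
    exact ⟨b, toDeterminize_injective hG ha ▸ h, hb⟩
  · rintro ⟨b, h, rfl⟩
    exact G.toDeterminize.map_edge _ _ _ h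

/-! ### Graphs in which full expansions need no folding -/

/-- The local condition at all vertices, for outgoing and for incoming edges. -/
structure LocallyTame (R : Set (List X × List X)) (G : WordGraph X) : Prop where
  out : Tame R List.head? G.Edge G.Reads
  into : Tame R List.getLast? (fun v x b => G.Edge b x v) fun v w b => G.Reads b w v

theorem LocallyTame.deterministic (h : G.LocallyTame R) : G.Deterministic :=
  ⟨fun _ _ _ _ => h.out.det, fun _ _ _ _ => h.into.det⟩

theorem linear_locallyTame (hR : IsAdian R) (w : List X) : (linear w).LocallyTame R := by
  constructor
  · refine Tame.of_subsingleton hR.left fun v x b x' b' h h' => ?_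
    have h : b.1 = v.1 ++ [x] := h
    have h' : b'.1 = v.1 ++ [x'] := h'
    have hb : b = b' := Subtype.ext <| List.IsPrefix.eq_of_length
      (List.prefix_of_prefix_length_le b.2 b'.2 (by simp [h, h'])) (by simp [h, h'])
    subst hb
    exact ⟨by simpa using h.symm.trans h', rfl⟩
  · refine Tame.of_subsingleton hR.right fun v x b x' b' h h' => ?_
    have h : v.1 = b.1 ++ [x] := h
    have h' : v.1 = b'.1 ++ [x'] := h'
    obtain ⟨h₁, h₂⟩ := List.append_inj' (h.symm.trans h') rfl
    exact ⟨by simpa using h₂, Subtype.ext h₁⟩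

theorem LocallyTame.sew (hR : IsAdian R) (h : G.LocallyTame R) :
    (G.sew {q | q.Unsaturated R}).LocallyTame R := by
  set Q : Set G.Segment := {q | q.Unsaturated R}
  have hne : ∀ q : Q, q.1.other ≠ [] := fun q => hR.ne_nil q.2.1.symm
  have hincl : ∀ {a w b}, G.Reads a w b → (G.sew Q).Reads (Sum.inl a) w (Sum.inl b) :=
    fun h => h.map (sewIncl G Q)
  constructor
  · refine Tame.extend hR.left
      (fun r s hrs => ⟨_, List.head?_eq_some_head (hR.ne_nil hrs)⟩) h.out Sum.inl
      -- Here `c` is the vertex after the first new edge; in the dual case below it is the vertex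
      -- before the last one.
      (fun v r s t c => ∃ hq : (⟨v, r, s, t⟩ : G.Segment) ∈ Q, G.sewPoint Q ⟨_, hq⟩ 1 = c)
      h.deterministic.reads_right Reads.exists_edge_head hincl SewEdge.old ?_ ?_ ?_ ?_
    · rintro v r s t _ _ ⟨_, rfl⟩ ⟨_, rfl⟩
      rfl
    · intro v x c e
      obtain e | ⟨⟨⟨v', r, s, t⟩, hq⟩, rfl, hx, hc⟩ := sew_edge_out_inl e
      · exact Or.inl e
      · exact Or.inr ⟨r, s, t, hq.1, hq.2.1, hq.2.2, hx, hq, hc⟩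
    · intro v r s t hrs hr hs
      exact sew_reads_other (⟨⟨v, r, s, t⟩, hrs, hr, hs⟩ : Q) (hne _)
    · rintro (z | z) hz x b x' b' e e'
      · exact absurd ⟨z, rfl⟩ hz
      · exact sew_edge_out_inr_unique e e'
  · refine Tame.extend hR.right
      (fun r s hrs => ⟨_, List.getLast?_eq_some_getLast (hR.ne_nil hrs)⟩) h.into Sum.inl
      (fun v r s t c => ∃ hq : (⟨t, r, s, v⟩ : G.Segment) ∈ Q,
        G.sewPoint Q ⟨_, hq⟩ (s.length - 1) = c)
      h.deterministic.reads_left Reads.exists_edge_getLast hincl SewEdge.old ?_ ?_ ?_ ?_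
    · rintro v r s t _ _ ⟨_, rfl⟩ ⟨_, rfl⟩
      rfl
    · intro v x c e
      obtain e | ⟨⟨⟨t, r, s, v'⟩, hq⟩, rfl, hx, hc⟩ := sew_edge_in_inl e
      · exact Or.inl e
      · exact Or.inr ⟨r, s, t, hq.1, hq.2.1, hq.2.2, hx, hq, hc⟩
    · intro v r s t hrs hr hs
      exact sew_reads_other (⟨⟨t, r, s, v⟩, hrs, hr, hs⟩ : Q) (hne _)
    · rintro (z | z) hz x b x' b' e e'
      · exact absurd ⟨z, rfl⟩ hz
      · exact sew_edge_in_inr_unique e e'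

theorem LocallyTame.determinize (h : G.LocallyTame R) : G.determinize.LocallyTame R where
  out := h.out.transport _ Quotient.mk_surjective (determinize_edge_out h.deterministic)
    fun h => h.map G.toDeterminize
  into := h.into.transport _ Quotient.mk_surjective (determinize_edge_in h.deterministic)
    fun h => h.map G.toDeterminize

end WordGraph

/-! ### Stephen's approximations need no folding and contain the graphs `Δ` -/

section Approximations

variable {X : Type u} {R : Set (List X × List X)}

theorem Γ_locallyTame (hR : IsAdian R) (w : List X) (n : ℕ) : (Γ R w n).LocallyTame R := by
  induction n with
  | zero => exact linear_locallyTame hR w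
  | succ n ih => exact (ih.sew hR).determinize

/-- The canonical homomorphism from `Γ_n(w)` to `Γ_{n+1}(w)`. -/
def ψ (R : Set (List X × List X)) (w : List X) (n : ℕ) : Hom (Γ R w n) (Γ R w (n + 1)) :=
  (toDeterminize _).comp (sewIncl _ _)

theorem ψ_injective (hR : IsAdian R) (w : List X) (n : ℕ) : (ψ R w n).IsEmbedding :=
  (toDeterminize_injective ((Γ_locallyTame hR w n).sew hR).deterministic).comp Sum.inl_injective

/-- A missing side is sewn on in the very next step; this yields saturation in the limit. -/
theorem ψ_saturates (hR : IsAdian R) (w : List X) (n : ℕ) {r s : List X} (hrs : IsRelation R r s)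
    {a b : (Γ R w n).V} (h : (Γ R w n).Reads a r b) :
    (Γ R w (n + 1)).Reads ((ψ R w n).toFun a) s ((ψ R w n).toFun b) := by
  by_cases hs : (Γ R w n).Reads a s b
  · exact hs.map _
  · exact (sew_reads_other (⟨⟨a, r, s, b⟩, hrs, h, hs⟩ :
      {q : (Γ R w n).Segment | q.Unsaturated R}) (hR.ne_nil hrs.symm)).map (toDeterminize _)

/-- A homomorphism from `Δ_n` to `Γ_n` that is injective and maps the segments that are to be
expanded to unsaturated segments. -/
theorem exists_embedding (hR : IsAdian R) (w r p : List X) (n : ℕ) :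
    ∃ θ : Hom (Δ R w r p n) (Γ R w n), θ.IsEmbedding ∧
      ∀ q ∈ (stage R w r p n).2, (q.map θ).Unsaturated R := by
  induction n with
  | zero => exact ⟨Hom.id _, Function.injective_id, fun q hq => hq.1⟩
  | succ n ih =>
    obtain ⟨θ, hθ, hQ⟩ := ih
    have hdet := ((Γ_locallyTame hR w n).sew hR).deterministic
    refine ⟨(toDeterminize _).comp (sewMap θ (stage R w r p n).2 {q | q.Unsaturated R} hQ),
      (toDeterminize_injective hdet).comp (sewMap_injective hθ), ?_⟩
    rintro ⟨a, u, v, b⟩ ⟨⟨huv, hu, -⟩, hz⟩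
    replace hu := Reads.map ((toDeterminize _).comp
      (sewMap θ (stage R w r p n).2 {q | q.Unsaturated R} hQ)) hu
    -- The two sides differ in their first and in their last letters, whereas at an interior vertex
    -- of a fresh segment only one letter leaves and only one enters. Since determinization is
    -- injective here, this remains true in `Γ`.
    refine ⟨huv, hu, fun hv => ?_⟩
    obtain ⟨z, hz⟩ | ⟨z, hz⟩ := hz
    · obtain rfl : a = Sum.inr z := hz
      have hx := List.head?_eq_some_head (hR.ne_nil huv)
      have hy := List.head?_eq_some_head (hR.ne_nil huv.symm)
      obtain ⟨c, hc⟩ := hu.exists_edge_head hx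
      obtain ⟨d, hd⟩ := hv.exists_edge_head hy
      obtain ⟨c, hc, -⟩ := (determinize_edge_out hdet).1 hc
      obtain ⟨d, hd, -⟩ := (determinize_edge_out hdet).1 hd
      have e := (sew_edge_out_inr_unique hc hd).1
      exact hR.left.apply_ne huv (by rw [hx, hy, e])
    · obtain rfl : b = Sum.inr z := hz
      have hx := List.getLast?_eq_some_getLast (hR.ne_nil huv)
      have hy := List.getLast?_eq_some_getLast (hR.ne_nil huv.symm)
      obtain ⟨c, hc⟩ := hu.exists_edge_getLast hx
      obtain ⟨d, hd⟩ := hv.exists_edge_getLast hy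
      obtain ⟨c, hc, -⟩ := (determinize_edge_in hdet).1 hc
      obtain ⟨d, hd, -⟩ := (determinize_edge_in hdet).1 hd
      have e := (sew_edge_in_inr_unique hc hd).1
      exact hR.right.apply_ne huv (by rw [hx, hy, e])

end Approximations

end AdianInverse

namespace AdianInverse

namespace WordGraph

variable {X : Type u}

/-! ### Direct limits of embeddings -/

section Limit

variable {G : ℕ → WordGraph X} {φ : ∀ n, Hom (G n) (G (n + 1))}

/-- The canonical homomorphism into the direct limit. -/
def limitOf (G : ℕ → WordGraph X) (φ : ∀ n, Hom (G n) (G (n + 1))) (n : ℕ) :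
    Hom (G n) (limit G φ) where
  toFun v := Quot.mk _ ⟨n, v⟩
  map_edge _ _ _ h := ⟨n, _, _, h, rfl, rfl⟩
  map_start := by
    induction n with
    | zero => rfl
    | succ n ih =>
      rw [← ih, ← (φ n).map_start]
      exact (Quot.sound ⟨n, _, rfl, rfl⟩).symm
  map_finish := by
    induction n with
    | zero => rfl
    | succ n ih =>
      rw [← ih, ← (φ n).map_finish]
      exact (Quot.sound ⟨n, _, rfl, rfl⟩).symm

theorem limitOf_succ (n : ℕ) (v : (G n).V) :
    (limitOf G φ (n + 1)).toFun ((φ n).toFun v) = (limitOf G φ n).toFun v :=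
  (Quot.sound ⟨n, v, rfl, rfl⟩).symm

theorem limitOf_injective (hφ : ∀ n, (φ n).IsEmbedding) (n : ℕ) :
    (limitOf G φ n).IsEmbedding := by
  intro u v huv
  let S : (Σ n, (G n).V) → (Σ n, (G n).V) → Prop :=
    fun a b => ∃ n v, a = ⟨n, v⟩ ∧ b = ⟨n + 1, (φ n).toFun v⟩
  have hfst : ∀ {a b}, Relation.ReflTransGen S a b → a.1 ≤ b.1 := by
    intro a b h
    induction h with
    | refl => exact le_rfl
    | tail _ h ih =>
      obtain ⟨m, x, rfl, rfl⟩ := h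
      exact ih.trans (Nat.le_succ m)
  -- Same-level elements with a common descendant coincide: peel off the last steps, using
  -- injectivity of the maps.
  have key : ∀ {a b c}, Relation.ReflTransGen S a c → Relation.ReflTransGen S b c →
      a.1 = b.1 → a = b := by
    intro a b c ha
    induction ha with
    | refl =>
      intro hb hab
      rcases hb.cases_tail with h | ⟨d, hd, m, x, rfl, rfl⟩
      · exact h
      · have := hfst hd
        simp only at this hab
        omega
    | @tail d c hd hdc ih =>
      intro hb hab
      obtain ⟨m, x, rfl, rfl⟩ := hdc
      rcases hb.cases_tail with h | ⟨d', hd', m', x', rfl, h⟩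
      · have := hfst hd
        rw [← h] at hab
        simp only at this hab
        omega
      · obtain rfl : m = m' := by simpa using congrArg Sigma.fst h
        obtain rfl := hφ m (eq_of_heq (Sigma.mk.inj h).2)
        exact ih hd' hab
  have hjoin : Relation.Join (Relation.ReflTransGen S) (⟨n, u⟩ : Σ n, (G n).V) ⟨n, v⟩ := by
    -- The step relation is functional, hence confluent, so the equivalence it generates is having a
    -- common descendant.
    have hcr : ∀ a b c, S a b → S a c → ∃ d, Relation.ReflGen S b d ∧
        Relation.ReflTransGen S c d := by
      rintro _ _ _ ⟨m, x, rfl, rfl⟩ ⟨m', x', h, rfl⟩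
      cases h
      exact ⟨_, .refl, .refl⟩
    have hequiv := Relation.equivalence_join_reflTransGen hcr
    refine (Equivalence.eqvGen_iff hequiv).1 ((Quot.eqvGen_exact huv).mono fun a b hab => ?_)
    exact ⟨b, .single hab, .refl⟩
  obtain ⟨c, h₁, h₂⟩ := hjoin
  exact eq_of_heq (Sigma.mk.inj (key h₁ h₂ rfl)).2

theorem exists_limitOf (x : (limit G φ).V) : ∃ n v, (limitOf G φ n).toFun v = x := by
  obtain ⟨⟨n, v⟩, rfl⟩ := Quot.exists_rep x
  exact ⟨n, v, rfl⟩

theorem exists_hom_of_le {n m : ℕ} (h : n ≤ m) : ∃ f : Hom (G n) (G m),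
    ∀ v, (limitOf G φ m).toFun (f.toFun v) = (limitOf G φ n).toFun v := by
  induction m, h using Nat.le_induction with
  | base => exact ⟨Hom.id _, fun _ => rfl⟩
  | succ m _ ih =>
    obtain ⟨f, hf⟩ := ih
    exact ⟨(φ m).comp f, fun v => (limitOf_succ m _).trans (hf v)⟩

theorem exists_limitOf₂ (x y : (limit G φ).V) :
    ∃ n u v, (limitOf G φ n).toFun u = x ∧ (limitOf G φ n).toFun v = y := by
  obtain ⟨n, u, rfl⟩ := exists_limitOf x
  obtain ⟨m, v, rfl⟩ := exists_limitOf y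
  obtain ⟨f, hf⟩ := exists_hom_of_le (φ := φ) (le_max_left n m)
  obtain ⟨g, hg⟩ := exists_hom_of_le (φ := φ) (le_max_right n m)
  exact ⟨_, _, _, hf u, hg v⟩

/-- A path is finite, so it lives at one stage; injectivity makes consecutive edges meet there
already. -/
theorem exists_reads_of_limit_reads (hφ : ∀ n, (φ n).IsEmbedding) {w : List X}
    {a b : (limit G φ).V} (h : (limit G φ).Reads a w b) : ∃ n u v, (G n).Reads u w v ∧
      (limitOf G φ n).toFun u = a ∧ (limitOf G φ n).toFun v = b := by
  induction w generalizing a with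
  | nil =>
    obtain rfl := reads_nil.1 h
    obtain ⟨n, v, rfl⟩ := exists_limitOf a
    exact ⟨n, v, v, reads_nil.2 rfl, rfl, rfl⟩
  | cons x w ih =>
    obtain ⟨c, ⟨n, u, c₁, he, rfl, hc₁⟩, hw⟩ := reads_cons.1 h
    obtain ⟨m, c₂, v, hr, hc₂, rfl⟩ := ih hw
    obtain ⟨f, hf⟩ := exists_hom_of_le (φ := φ) (le_max_left n m)
    obtain ⟨g, hg⟩ := exists_hom_of_le (φ := φ) (le_max_right n m)
    have hc : f.toFun c₁ = g.toFun c₂ :=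
      limitOf_injective hφ _ ((hf c₁).trans (hc₁.trans (hc₂.symm.trans (hg c₂).symm)))
    exact ⟨_, _, _, reads_cons.2 ⟨_, f.map_edge _ _ _ he, hc ▸ hr.map g⟩, hf u, hg v⟩

theorem limit_deterministic (hφ : ∀ n, (φ n).IsEmbedding) (hG : ∀ n, (G n).Deterministic) :
    (limit G φ).Deterministic := by
  constructor
  · rintro _ x _ _ ⟨n, u, v, h, rfl, rfl⟩ ⟨m, u', v', h', huu, rfl⟩
    obtain ⟨f, hf⟩ := exists_hom_of_le (φ := φ) (le_max_left n m)
    obtain ⟨g, hg⟩ := exists_hom_of_le (φ := φ) (le_max_right n m)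
    have hu : g.toFun u' = f.toFun u :=
      limitOf_injective hφ _ ((hg u').trans (huu.trans (hf u).symm))
    have hv := (hG _).1 _ _ _ _ (f.map_edge _ _ _ h) (hu ▸ g.map_edge _ _ _ h')
    exact (hf v).symm.trans ((congrArg _ hv).trans (hg v'))
  · rintro _ x _ _ ⟨n, v, u, h, rfl, rfl⟩ ⟨m, v', u', h', rfl, huu⟩
    obtain ⟨f, hf⟩ := exists_hom_of_le (φ := φ) (le_max_left n m)
    obtain ⟨g, hg⟩ := exists_hom_of_le (φ := φ) (le_max_right n m)
    have hu : g.toFun u' = f.toFun u :=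
      limitOf_injective hφ _ ((hg u').trans (huu.trans (hf u).symm))
    have hv := (hG _).2 _ _ _ _ (f.map_edge _ _ _ h) (hu ▸ g.map_edge _ _ _ h')
    exact (hf v).symm.trans ((congrArg _ hv).trans (hg v'))

/-- The homomorphism from a direct limit that is defined by a compatible family. -/
def limitLift {H : WordGraph X} (f : ∀ n, Hom (G n) H)
    (hf : ∀ n v, (f (n + 1)).toFun ((φ n).toFun v) = (f n).toFun v) : Hom (limit G φ) H where
  toFun := Quot.lift (fun a => (f a.1).toFun a.2) (by
    rintro _ _ ⟨n, v, rfl, rfl⟩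
    exact (hf n v).symm)
  map_edge := by
    rintro _ x _ ⟨n, u, v, h, rfl, rfl⟩
    exact (f n).map_edge _ _ _ h
  map_start := (f 0).map_start
  map_finish := (f 0).map_finish

end Limit

/-! ### The action of the inverse monoid on the vertices of a saturated graph -/

section Action

variable {R : Set (List X × List X)} {G : WordGraph X}

/-- `(a, e, b)` is an edge, for a letter `e` of `X ∪ X⁻¹`. -/
def SignedEdge (G : WordGraph X) (a : G.V) (e : X × Bool) (b : G.V) : Prop :=
  if e.2 then G.Edge a e.1 b else G.Edge b e.1 a

/-- The word `t` over `X ∪ X⁻¹` labels a path from `a` to `b`. -/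
def Run (G : WordGraph X) : List (X × Bool) → G.V → G.V → Prop
  | [], a, b => a = b
  | e :: t, a, b => ∃ c, G.SignedEdge a e c ∧ Run G t c b

theorem run_append {t₁ t₂ : List (X × Bool)} {a b : G.V} :
    G.Run (t₁ ++ t₂) a b ↔ ∃ c, G.Run t₁ a c ∧ G.Run t₂ c b := by
  induction t₁ generalizing a with
  | nil => simp [Run]
  | cons e t ih =>
    simp only [List.cons_append, Run, ih]
    exact ⟨fun ⟨c, h, d, h₁, h₂⟩ => ⟨d, ⟨c, h, h₁⟩, h₂⟩, fun ⟨d, ⟨c, h, h₁⟩, h₂⟩ => ⟨c, h, d, h₁, h₂⟩⟩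

theorem run_mul {t₁ t₂ : FreeMonoid (X × Bool)} {a b : G.V} :
    G.Run (t₁ * t₂).toList a b ↔ ∃ c, G.Run t₁.toList a c ∧ G.Run t₂.toList c b :=
  run_append

theorem run_invRev {t : List (X × Bool)} {a b : G.V} :
    G.Run (FreeGroup.invRev t) a b ↔ G.Run t b a := by
  induction t generalizing b with
  | nil => exact eq_comm
  | cons e t ih =>
    have h : FreeGroup.invRev (e :: t) = FreeGroup.invRev t ++ [(e.1, !e.2)] := by
      simp [FreeGroup.invRev]
    rw [h, run_append]
    simp only [ih, Run]
    refine ⟨fun ⟨c, h₁, d, h₂, hd⟩ => ⟨c, ?_, h₁⟩, fun ⟨c, h₁, h₂⟩ => ⟨c, h₂, b, ?_, rfl⟩⟩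
    · subst hd
      rcases e with ⟨x, _ | _⟩ <;> simpa [SignedEdge] using h₂
    · rcases e with ⟨x, _ | _⟩ <;> simpa [SignedEdge] using h₁

theorem run_invWord {t : FreeMonoid (X × Bool)} {a b : G.V} :
    G.Run (invWord t).toList a b ↔ G.Run t.toList b a := run_invRev

theorem run_posWord {w : List X} {a b : G.V} :
    G.Run (posWord w).toList a b ↔ G.Reads a w b := by
  change G.Run (w.map fun x => (x, true)) a b ↔ _
  induction w generalizing a with
  | nil => exact reads_nil.symm
  | cons x w ih => simp [Run, reads_cons, ih, SignedEdge]

theorem Deterministic.run_right (hG : G.Deterministic) {t : List (X × Bool)} {a b c : G.V}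
    (hb : G.Run t a b) (hc : G.Run t a c) : b = c := by
  induction t generalizing a with
  | nil => exact hb.symm.trans hc
  | cons e t ih =>
    obtain ⟨d, hd, hb⟩ := hb
    obtain ⟨d', hd', hc⟩ := hc
    obtain rfl : d = d' := by
      rcases e with ⟨x, _ | _⟩
      · exact hG.2 _ _ _ _ (by simpa [SignedEdge] using hd) (by simpa [SignedEdge] using hd')
      · exact hG.1 _ _ _ _ (by simpa [SignedEdge] using hd) (by simpa [SignedEdge] using hd')
    exact ih hb hc

theorem Deterministic.run_left (hG : G.Deterministic) {t : List (X × Bool)} {a b c : G.V}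
    (hb : G.Run t b a) (hc : G.Run t c a) : b = c :=
  hG.run_right (run_invRev.2 hb) (run_invRev.2 hc)

/-- Words act as partial injections, so `t * invWord t` acts as the identity on the domain of `t`.
-/
theorem Deterministic.run_idempotent (hG : G.Deterministic) {t : FreeMonoid (X × Bool)}
    {a b : G.V} : G.Run (t * invWord t).toList a b ↔ a = b ∧ ∃ c, G.Run t.toList a c := by
  rw [run_mul]
  simp only [run_invWord]
  constructor
  · rintro ⟨c, h₁, h₂⟩
    exact ⟨hG.run_left h₁ h₂, c, h₁⟩
  · rintro ⟨rfl, c, h⟩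
    exact ⟨c, h, h⟩

/-- The congruence that identifies the words inducing the same partial map of the vertices. -/
def runCon (G : WordGraph X) : Con (FreeMonoid (X × Bool)) where
  r s t := ∀ a b, G.Run s.toList a b ↔ G.Run t.toList a b
  iseqv := ⟨fun _ _ _ => Iff.rfl, fun h a b => (h a b).symm, fun h h' a b => (h a b).trans (h' a b)⟩
  mul' h h' a b := by simp only [run_mul, h _ _, h' _ _]

/-- Partial injections satisfy the Vagner relations, since restrictions of the identity commute;
saturation supplies the defining relations. -/
theorem Deterministic.conGen_le_runCon (hG : G.Deterministic)
    (hsat : ∀ r s a b, IsRelation R r s → G.Reads a r b → G.Reads a s b) :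
    conGen (InvRel R) ≤ G.runCon := by
  refine Con.conGen_le.2 ?_
  rintro _ _ (⟨t⟩ | ⟨s, t⟩ | ⟨h⟩) a b
  · rw [run_mul]
    simp only [hG.run_idempotent]
    exact ⟨fun ⟨c, ⟨h, _⟩, h'⟩ => h ▸ h', fun h => ⟨a, ⟨rfl, b, h⟩, h⟩⟩
  · rw [run_mul, run_mul]
    simp only [hG.run_idempotent]
    exact ⟨fun ⟨c, ⟨h₁, h₂⟩, h₃, h₄⟩ => ⟨a, ⟨rfl, h₁ ▸ h₄⟩, h₁.trans h₃, h₂⟩,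
      fun ⟨c, ⟨h₁, h₂⟩, h₃, h₄⟩ => ⟨a, ⟨rfl, h₁ ▸ h₄⟩, h₁.trans h₃, h₂⟩⟩
  · rw [run_posWord, run_posWord]
    exact ⟨hsat _ _ _ _ (Or.inl h), hsat _ _ _ _ (Or.inr h)⟩

theorem Deterministic.run_iff_of_mk_eq (hG : G.Deterministic)
    (hsat : ∀ r s a b, IsRelation R r s → G.Reads a r b → G.Reads a s b)
    {s t : FreeMonoid (X × Bool)} (h : Inv.mk R s = Inv.mk R t) (a b : G.V) :
    G.Run s.toList a b ↔ G.Run t.toList a b :=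
  hG.conGen_le_runCon hsat ((Con.eq _).1 h) a b

end Action

/-! ### Homomorphisms into Schützenberger graphs -/

section Schutzenberger

variable {R : Set (List X × List X)} {w : List X}

theorem mk_posWord_append (u v : List X) :
    Inv.mk R (posWord (u ++ v)) = Inv.mk R (posWord u) * Inv.mk R (posWord v) := by
  rw [posWord, List.map_append]
  rfl

theorem mk_posWord_eq {r s : List X} (h : IsRelation R r s) :
    Inv.mk R (posWord r) = Inv.mk R (posWord s) :=
  h.elim (fun h => (Con.eq _).2 (ConGen.Rel.of _ _ (InvRel.rel h)))
    fun h => ((Con.eq _).2 (ConGen.Rel.of _ _ (InvRel.rel h))).symm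

theorem SΓ_reads {u : List X} {a b : (SΓ R w).V} (h : (SΓ R w).Reads a u b) :
    a.1 * Inv.mk R (posWord u) = b.1 := by
  induction u generalizing a with
  | nil => rw [reads_nil.1 h]; exact mul_one _
  | cons x u ih =>
    obtain ⟨c, hc, h⟩ := reads_cons.1 h
    have hc : a.1 * Inv.mk R (posWord [x]) = c.1 := hc
    rw [← List.singleton_append, mk_posWord_append, ← mul_assoc, hc, ih h]

/-- The homomorphism from the linear automaton of `w` to the Schützenberger graph of `w`. -/
def linearLift (R : Set (List X × List X)) (w : List X) : Hom (linear w) (SΓ R w) where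
  toFun v := ⟨Inv.mk R (posWord w * invWord (posWord w)) * Inv.mk R (posWord v.1),
    ⟨Inv.mk R (invWord (posWord w)) * Inv.mk R (posWord v.1), (mul_assoc _ _ _).symm⟩, by
      -- Completing the prefix to `w` by `u` leads back to `ww⁻¹w = w`.
      obtain ⟨u, hu⟩ := v.2
      refine ⟨Inv.mk R (posWord u), ?_⟩
      rw [mul_assoc, ← mk_posWord_append, hu]
      exact Inv.mk_regular R _⟩
  map_edge a x b h := by
    have h : b.1 = a.1 ++ [x] := h
    change _ * _ * _ = _ * _
    rw [h, mk_posWord_append, mul_assoc]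
  map_start := Subtype.ext (mul_one _)
  map_finish := Subtype.ext (Inv.mk_regular R _)

/-- Homomorphisms into the Schützenberger graph extend over elementary expansions. -/
def sewLift {G : WordGraph X} (f : Hom G (SΓ R w)) (Q : Set G.Segment)
    (hQ : ∀ q ∈ Q, IsRelation R q.side q.other ∧ G.Reads q.src q.side q.tgt) :
    Hom (G.sew Q) (SΓ R w) :=
  -- Both sides represent the same element, so the new segment ends where the old one does.
  have htgt : ∀ q : Q, (f.toFun q.1.src).1 * Inv.mk R (posWord q.1.other) =
      (f.toFun q.1.tgt).1 := fun q => by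
    rw [← mk_posWord_eq (hQ _ q.2).1]
    exact SΓ_reads ((hQ _ q.2).2.map f)
  let g : (G.sew Q).V → (SΓ R w).V := Sum.elim f.toFun fun z =>
    -- Interior vertices are numbered from zero, so vertex `k` lies after `k + 1` letters. The
    -- remaining letters lead to the target and from there to `w`, which keeps it in the component.
    ⟨(f.toFun z.1.1.src).1 * Inv.mk R (posWord (z.1.1.other.take (z.2.1 + 1))), by
      obtain ⟨a, ha⟩ := (f.toFun z.1.1.src).2.1
      exact ⟨a * Inv.mk R (posWord (z.1.1.other.take (z.2.1 + 1))), by rw [← mul_assoc, ha]⟩, by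
      obtain ⟨b, hb⟩ := (f.toFun z.1.1.tgt).2.2
      refine ⟨Inv.mk R (posWord (z.1.1.other.drop (z.2.1 + 1))) * b, ?_⟩
      rw [mul_assoc, ← mul_assoc (Inv.mk R _) _ b, ← mk_posWord_append, List.take_append_drop,
        ← mul_assoc, htgt, hb]⟩
  have hg : ∀ (q : Q) j, (g (G.sewPoint Q q j)).1 =
      (f.toFun q.1.src).1 * Inv.mk R (posWord (q.1.other.take j)) := by
    rintro q (_ | j)
    · exact (mul_one _).symm
    · by_cases hj : j < q.1.other.length - 1
      · rw [sewPoint_succ_of_lt hj]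
        rfl
      · rw [sewPoint_succ_of_not_lt hj, List.take_of_length_le (by omega), htgt]
        rfl
  { toFun := g
    map_edge := by
      intro a x b e
      cases e with
      | old e => exact f.map_edge _ _ _ e
      | @new q j x hx =>
        change _ * _ = _
        rw [hg, hg, mul_assoc, ← mk_posWord_append]
        obtain ⟨hj, rfl⟩ := List.getElem?_eq_some_iff.1 hx
        rw [List.take_succ_eq_append_getElem hj]
    map_start := f.map_start
    map_finish := f.map_finish }

end Schutzenberger

/-! ### Reachability in graphs with sewn-on segments -/

section Reachability

variable {R : Set (List X × List X)} {G : WordGraph X}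

theorem linear_reads {w : List X} (u v : List X) (h : u ++ v <+: w) :
    (linear w).Reads ⟨u, (List.prefix_append u v).trans h⟩ v ⟨u ++ v, h⟩ := by
  induction v generalizing u with
  | nil => exact reads_nil.2 (Subtype.ext (List.append_nil u).symm)
  | cons x v ih =>
    have h' : (u ++ [x]) ++ v <+: w := by simpa using h
    refine reads_cons.2 ⟨⟨u ++ [x], (List.prefix_append _ v).trans h'⟩, rfl, ?_⟩
    have := ih (u ++ [x]) h'
    simpa using this

/-- The initial vertex is a source from which every vertex can be reached by a positively labeled
path, and the terminal vertex is a sink that can be reached from every vertex. -/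
structure Transversal (G : WordGraph X) : Prop where
  isSource : G.IsSource G.start
  isSink : G.IsSink G.finish
  from_start : ∀ v, ∃ u, G.Reads G.start u v
  to_finish : ∀ v, ∃ u, G.Reads v u G.finish

theorem linear_transversal (w : List X) : (linear w).Transversal where
  isSource a x h := by
    have h : [] = a.1 ++ [x] := h
    simp at h
  isSink x b h := by
    have h : b.1 = w ++ [x] := h
    have := b.2.length_le
    simp [h] at this
  from_start v := ⟨v.1, linear_reads [] v.1 v.2⟩
  to_finish v := by
    obtain ⟨v, u, rfl⟩ := v
    exact ⟨u, linear_reads v u List.prefix_rfl⟩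

/-- A segment sewn on at the initial vertex cannot end there: the old side parallel to it would end
there too. Dually for the terminal vertex. Interior vertices are reached through the ends of their
segments. -/
theorem Transversal.sew (hR : IsAdian R) (h : G.Transversal) (Q : Set G.Segment)
    (hQ : ∀ q ∈ Q, IsRelation R q.side q.other ∧ G.Reads q.src q.side q.tgt) :
    (G.sew Q).Transversal := by
  have hs : ∀ v, ∃ u, (G.sew Q).Reads (G.sew Q).start u (Sum.inl v) := fun v =>
    (h.from_start v).imp fun u hu => hu.map (sewIncl G Q)
  have hf : ∀ v, ∃ u, (G.sew Q).Reads (Sum.inl v) u (G.sew Q).finish := fun v =>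
    (h.to_finish v).imp fun u hu => hu.map (sewIncl G Q)
  refine ⟨fun a x e => ?_, fun x b e => ?_, ?_, ?_⟩
  · obtain ⟨b, e, -⟩ | ⟨q, hq, -⟩ := sew_edge_in_inl e
    · exact h.isSource _ _ e
    · obtain ⟨hrs, hr⟩ := hQ _ q.2
      obtain ⟨c, hc⟩ := hr.exists_edge_getLast (List.getLast?_eq_some_getLast (hR.ne_nil hrs))
      exact h.isSource _ _ (hq ▸ hc)
  · obtain ⟨b, e, -⟩ | ⟨q, hq, -⟩ := sew_edge_out_inl e
    · exact h.isSink _ _ e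
    · obtain ⟨hrs, hr⟩ := hQ _ q.2
      obtain ⟨c, hc⟩ := hr.exists_edge_head (List.head?_eq_some_head (hR.ne_nil hrs))
      exact h.isSink _ _ (hq ▸ hc)
  · rintro (v | ⟨q, ⟨k, hk⟩⟩)
    · exact hs v
    · obtain ⟨u, hu⟩ := hs q.1.src
      have := sew_reads_take q (k + 1) (by omega)
      rw [sewPoint_succ_of_lt hk] at this
      exact ⟨_, reads_append.2 ⟨_, hu, this⟩⟩
  · rintro (v | ⟨q, ⟨k, hk⟩⟩)
    · exact hf v
    · obtain ⟨u, hu⟩ := hf q.1.tgt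
      have := sew_reads_drop q (hR.ne_nil (hQ _ q.2).1.symm) (k + 1) (by omega)
      rw [sewPoint_succ_of_lt hk] at this
      exact ⟨_, reads_append.2 ⟨_, this, hu⟩⟩

theorem Transversal.limit {G : ℕ → WordGraph X} {φ : ∀ n, Hom (G n) (G (n + 1))}
    (hφ : ∀ n, (φ n).IsEmbedding) (h : ∀ n, (G n).Transversal) :
    (limit G φ).Transversal := by
  refine ⟨?_, ?_, fun x => ?_, fun x => ?_⟩
  · rintro _ x ⟨n, u, v, e, rfl, hv⟩
    obtain rfl := limitOf_injective hφ n (hv.trans (limitOf G φ n).map_start.symm)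
    exact (h n).isSource _ _ e
  · rintro x _ ⟨n, u, v, e, hu, rfl⟩
    obtain rfl := limitOf_injective hφ n (hu.trans (limitOf G φ n).map_finish.symm)
    exact (h n).isSink _ _ e
  · obtain ⟨n, v, rfl⟩ := exists_limitOf x
    obtain ⟨u, hu⟩ := (h n).from_start v
    exact ⟨u, (limitOf G φ n).map_start ▸ hu.map _⟩
  · obtain ⟨n, v, rfl⟩ := exists_limitOf x
    obtain ⟨u, hu⟩ := (h n).to_finish v
    exact ⟨u, (limitOf G φ n).map_finish ▸ hu.map _⟩

/-- A nonempty path from the initial vertex would supply an edge entering `v`. -/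
theorem Transversal.eq_start (h : G.Transversal) {v : G.V} (hv : G.IsSource v) :
    v = G.start := by
  obtain ⟨u, hu⟩ := h.from_start v
  rcases u.eq_nil_or_concat with rfl | ⟨u, x, rfl⟩
  · exact (reads_nil.1 hu).symm
  · obtain ⟨c, hc⟩ := hu.exists_edge_getLast (x := x) (by simp)
    exact absurd hc (hv _ _)

theorem Transversal.eq_finish (h : G.Transversal) {v : G.V} (hv : G.IsSink v) :
    v = G.finish := by
  obtain ⟨_ | ⟨x, u⟩, hu⟩ := h.to_finish v
  · exact reads_nil.1 hu
  · obtain ⟨c, hc, -⟩ := reads_cons.1 hu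
    exact absurd hc (hv _ _)

end Reachability

end WordGraph

/-! ### Assembling the results: embedding into the Schützenberger graph -/

section Main

variable {X : Type u} {R : Set (List X × List X)}

theorem stage_reads (w r p : List X) (n : ℕ) :
    ∀ q ∈ (stage R w r p n).2, IsRelation R q.side q.other ∧
      (stage R w r p n).1.Reads q.src q.side q.tgt := by
  cases n with
  | zero => exact fun q hq => ⟨hq.1.1, hq.1.2.1⟩
  | succ n => exact fun q hq => ⟨hq.1.1, hq.1.2.1⟩

theorem φ_injective (w r p : List X) (n : ℕ) : (φ R w r p n).IsEmbedding := Sum.inl_injective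

theorem Δ_transversal (hR : IsAdian R) (w r p : List X) (n : ℕ) :
    (Δ R w r p n).Transversal := by
  induction n with
  | zero => exact linear_transversal w
  | succ n ih => exact Transversal.sew hR ih _ (stage_reads w r p n)

theorem Δ_deterministic (hR : IsAdian R) (w r p : List X) (n : ℕ) :
    (Δ R w r p n).Deterministic := by
  obtain ⟨θ, hθ, -⟩ := exists_embedding hR w r p n
  have hdet := (Γ_locallyTame hR w n).deterministic
  exact ⟨fun _ _ _ _ h h' => hθ (hdet.1 _ _ _ _ (θ.map_edge _ _ _ h) (θ.map_edge _ _ _ h')),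
    fun _ _ _ _ h h' => hθ (hdet.2 _ _ _ _ (θ.map_edge _ _ _ h) (θ.map_edge _ _ _ h'))⟩

/-- The homomorphism from `Δ_n` to the Schützenberger graph of `w`. -/
def toSΓ (R : Set (List X × List X)) (w r p : List X) : ∀ n, Hom (Δ R w r p n) (SΓ R w)
  | 0 => linearLift R w
  | n + 1 => sewLift (toSΓ R w r p n) (stage R w r p n).2 (stage_reads w r p n)

theorem limit_Γ_deterministic (hR : IsAdian R) (w : List X) :
    (limit (Γ R w) (ψ R w)).Deterministic :=
  limit_deterministic (ψ_injective hR w) fun n => (Γ_locallyTame hR w n).deterministic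

theorem limit_Γ_saturated (hR : IsAdian R) (w : List X) {r s : List X}
    {a b : (limit (Γ R w) (ψ R w)).V} (hrs : IsRelation R r s)
    (h : (limit (Γ R w) (ψ R w)).Reads a r b) : (limit (Γ R w) (ψ R w)).Reads a s b := by
  obtain ⟨n, u, v, huv, rfl, rfl⟩ := exists_reads_of_limit_reads (ψ_injective hR w) h
  have := (ψ_saturates hR w n hrs huv).map (limitOf _ (ψ R w) (n + 1))
  rwa [limitOf_succ, limitOf_succ] at this

/-- The limit of the `Γ R w n` serves as a test space: equal elements of the monoid act equally on
it, and acting on its initial vertex separates the vertices of `Δ`. -/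
theorem toSΓ_injective (hR : IsAdian R) (w r p : List X) (n : ℕ) :
    (toSΓ R w r p n).IsEmbedding := by
  intro a b hab
  obtain ⟨θ, hθ, -⟩ := exists_embedding hR w r p n
  set H := limit (Γ R w) (ψ R w)
  have hH : H.Deterministic := limit_Γ_deterministic hR w
  let η : Hom (Δ R w r p n) H := (limitOf _ _ n).comp θ
  have hη : η.IsEmbedding := (limitOf_injective (ψ_injective hR w) n).comp hθ
  have hw : H.Reads H.start w H.finish :=
    (linear_reads [] w List.prefix_rfl).map (limitOf (Γ R w) (ψ R w) 0)
  -- Since `w` is readable at the initial vertex, `ww⁻¹` fixes that vertex, and `u` then leads to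
  -- the image of `v`.
  have hrun : ∀ {u v}, (Δ R w r p n).Reads (Δ R w r p n).start u v →
      H.Run (posWord w * invWord (posWord w) * posWord u).toList H.start (η.toFun v) := by
    intro u v h
    refine run_mul.2 ⟨_, hH.run_idempotent.2 ⟨rfl, _, run_posWord.2 hw⟩, run_posWord.2 ?_⟩
    exact η.map_start ▸ h.map η
  have hval : ∀ {u v}, (Δ R w r p n).Reads (Δ R w r p n).start u v →
      Inv.mk R (posWord w * invWord (posWord w) * posWord u) = ((toSΓ R w r p n).toFun v).1 := by
    intro u v h
    have := SΓ_reads (h.map (toSΓ R w r p n))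
    rwa [(toSΓ R w r p n).map_start] at this
  obtain ⟨u, hu⟩ := (Δ_transversal hR w r p n).from_start a
  obtain ⟨v, hv⟩ := (Δ_transversal hR w r p n).from_start b
  have huv := (hval hu).trans ((congrArg Subtype.val hab).trans (hval hv).symm)
  have h := (hH.run_iff_of_mk_eq (fun _ _ _ _ => limit_Γ_saturated hR w) huv _ _).1 (hrun hu)
  exact hη (hH.run_right h (hrun hv))

theorem exists_embedding_SΓ (hR : IsAdian R) (w r p : List X) :
    ∃ ι : Hom (ΔLimit R w r p) (SΓ R w), ι.IsEmbedding := by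
  refine ⟨limitLift (toSΓ R w r p) fun n v => rfl, fun x y hxy => ?_⟩
  obtain ⟨n, u, v, rfl, rfl⟩ := exists_limitOf₂ x y
  exact congrArg _ (toSΓ_injective hR w r p n hxy)

end Main

end AdianInverse

theorem proposition3 {X : Type u} (R : Set (List X × List X)) (hR : IsAdian R)
    (w r p : List X) (hr : IsRWord R r) (hp : p ++ r <+: w) :
    -- (i)
    (∀ n, ∃ θ : Hom (Δ R w r p n) (Γ R w n), θ.IsEmbedding ∧ ∀ θ', θ' = θ) ∧
    -- (ii)
    (∀ n, (Δ R w r p n).Deterministic ∧ (φ R w r p n).IsEmbedding ∧ ∀ φ', φ' = φ R w r p n) ∧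
    -- the limit is a birooted subgraph of the Schützenberger graph of `w`
    (∃ ι : Hom (ΔLimit R w r p) (SΓ R w), ι.IsEmbedding) ∧
    -- (iii)
    ((ΔLimit R w r p).IsSource (ΔLimit R w r p).start ∧
      (∀ γ, (ΔLimit R w r p).IsSource γ → γ = (ΔLimit R w r p).start) ∧
      (ΔLimit R w r p).IsSink (ΔLimit R w r p).finish ∧
      (∀ γ, (ΔLimit R w r p).IsSink γ → γ = (ΔLimit R w r p).finish)) ∧
    -- (iv)
    ((∀ γ, γ ≠ (ΔLimit R w r p).start →
        ∃ l, (ΔLimit R w r p).IsPath (ΔLimit R w r p).start l γ) ∧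
      (∀ γ, γ ≠ (ΔLimit R w r p).finish →
        ∃ l, (ΔLimit R w r p).IsPath γ l (ΔLimit R w r p).finish)) ∧
    -- (v)
    (∀ γ₁ l γ₂, (ΔLimit R w r p).IsPath γ₁ l γ₂ →
      ∃ l₁ l₂, (ΔLimit R w r p).IsPath (ΔLimit R w r p).start l₁ γ₁ ∧
        (ΔLimit R w r p).IsPath γ₂ l₂ (ΔLimit R w r p).finish ∧
        (ΔLimit R w r p).IsPath (ΔLimit R w r p).start (l₁ ++ l ++ l₂)
          (ΔLimit R w r p).finish) := by
  have hT := Transversal.limit (φ_injective w r p) (Δ_transversal (R := R) hR w r p)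
  refine ⟨fun n => ?_, fun n => ⟨Δ_deterministic hR w r p n, φ_injective w r p n, fun φ' => ?_⟩,
    exists_embedding_SΓ hR w r p,
    ⟨hT.isSource, fun _ => hT.eq_start, hT.isSink, fun _ => hT.eq_finish⟩,
    ⟨fun γ _ => ?_, fun γ _ => ?_⟩, fun γ₁ l γ₂ h => ?_⟩
  · obtain ⟨θ, hθ, -⟩ := exists_embedding hR w r p n
    exact ⟨θ, hθ, fun θ' => Hom.unique (Δ_transversal hR w r p n).from_start
      (Γ_locallyTame hR w n).deterministic θ' θ⟩
  · exact Hom.unique (Δ_transversal hR w r p n).from_start (Δ_deterministic hR w r p (n + 1)) φ' _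
  · obtain ⟨_, l, hl, -⟩ := hT.from_start γ
    exact ⟨l, hl⟩
  · obtain ⟨_, l, hl, -⟩ := hT.to_finish γ
    exact ⟨l, hl⟩
  · obtain ⟨_, l₁, h₁, -⟩ := hT.from_start γ₁
    obtain ⟨_, l₂, h₂, -⟩ := hT.to_finish γ₂
    exact ⟨l₁, l₂, h₁, h₂, isPath_append.2 ⟨_, isPath_append.2 ⟨_, h₁, h⟩, h₂⟩⟩
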